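/- Let $\mathcal L$ and $\mathcal K$ be accessible categories and let $F\colon \mathcal L\to\mathcal K$ be an accessible functor, i.e. a functor that preserves $\lambda$-directed colimits for some regular cardinal $\lambda$. (A category is accessible if, for some regular cardinal $\lambda$, it is locally small, has $\lambda$-directed colimits, and has a set $\mathcal A$ of $\lambda$-presentable objects such that every object is a $\lambda$-directed colimit of objects from $\mathcal A$.) Let $F(\mathcal L)$ be the full image of $F$, i.e. the full subcategory of $\mathcal K$ consisting of the objects $FL$ with $L$ in $\mathcal L$. Then $F(\mathcal L)$ is cone-reflective in $\mathcal K$. That is, $F(\mathcal L)$ satisfies the solution-set condition at every object $K$ of $\mathcal K$: there is a set of morphisms $(f_i\colon K\to L_i)_{i\in I}$ with every $L_i$ in $F(\mathcal L)$, such that every morphism $f\colon K\to L$ with $L$ in $F(\mathcal L)$ factorizes as $f=g f_i$ for some $i\in I$ and some morphism $g\colon L_i\to L$. -/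

import Mathlib

open CategoryTheory

universe w v u v₁ u₁

namespace CategoryTheory

/-- The full image of a functor `F : L ⥤ K`: the full subcategory of `K` (given by its property
of objects) that consists of the objects `F.obj X`, for `X` in `L`. -/
def Functor.fullImage {L : Type u₁} [Category.{v₁} L] {K : Type u} [Category.{v} K]
    (F : L ⥤ K) : ObjectProperty K :=
  fun Y => ∃ X : L, F.obj X = Y

/-- The full subcategory `P` of `C` satisfies the solution-set condition at the object `X`: there
is a set (a family indexed by a type in the universe `w` of sets) of morphisms `f i : X ⟶ B i`
with `B i` in `P`, such that each morphism `h : X ⟶ Y` with `Y` in `P` factors through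
some `f i`. -/
def ObjectProperty.SolutionSetConditionAt {C : Type u} [Category.{v} C]
    (P : ObjectProperty C) (X : C) : Prop :=
  ∃ (ι : Type w) (B : ι → C) (f : ∀ i : ι, X ⟶ B i), (∀ i, P (B i)) ∧
    ∀ (Y : C), P Y → ∀ h : X ⟶ Y, ∃ (i : ι) (g : B i ⟶ Y), h = f i ≫ g

/-- The full subcategory `P` of `C` is cone-reflective in `C`: it satisfies the solution-set
condition at each object of `C`. -/
def ObjectProperty.IsConeReflective {C : Type u} [Category.{v} C]
    (P : ObjectProperty C) : Prop :=
  ∀ X : C, ObjectProperty.SolutionSetConditionAt.{w} P X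

end CategoryTheory

open Limits

namespace CategoryTheory

/-! Let `L` be `κ`-accessible with generator `P`. Every object `X` of `K` is presentable, so some `ν
≥ κ` bounds the ranks of `X` and `F`; put `κ' = (2 ^ ν)⁺`. As `κ` is sharply smaller than `κ'`, a
`κ`-directed colimit of objects of `P` is a `κ'`-directed colimit of its `κ'`-small `κ`-directed
subcolimits (`isColimitCoconeOverSubsets`, `exists_isCardinalFiltered_superset`). `F` preserves the
outer colimit, so `X ⟶ F.obj Y` factors through `F.obj Z` for one such subcolimit `Z`. These `Z`
form an essentially small class, whence a solution set. -/

section SubsetDecomposition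

variable {α : Type w} [PartialOrder α] {C : Type u} [Category.{v} C] (D : α ⥤ C)

/-- The restriction of a diagram indexed by a partially ordered type to a subset. -/
abbrev restrictToSet (S : Set α) : S ⥤ C :=
  (Subtype.mono_coe (fun x => x ∈ S)).functor ⋙ D

variable (P : Set α → Prop) [∀ S : Subtype P, HasColimit (restrictToSet D S.1)]

variable {P} in
/-- The morphism between the colimits of the restrictions of `D` to `S` and `T` when `S ≤ T`. -/
noncomputable def colimitOverSubsetsMap {S T : Subtype P} (h : S ≤ T) :
    colimit (restrictToSet D S.1) ⟶ colimit (restrictToSet D T.1) :=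
  colimit.desc (restrictToSet D S.1)
    { pt := colimit (restrictToSet D T.1)
      ι :=
        { app := fun x => colimit.ι (restrictToSet D T.1) ⟨x.1, h x.2⟩
          naturality := fun x y f => by
            have hf : (⟨x.1, h x.2⟩ : T.1) ≤ ⟨y.1, h y.2⟩ := leOfHom f
            exact (colimit.w (restrictToSet D T.1) (homOfLE hf)).trans
              (Category.comp_id _).symm } }

variable {P} in
lemma ι_colimitOverSubsetsMap {S T : Subtype P} (h : S ≤ T) (x : α) (hx : x ∈ S.1) :
    colimit.ι (restrictToSet D S.1) ⟨x, hx⟩ ≫ colimitOverSubsetsMap D h =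
      colimit.ι (restrictToSet D T.1) ⟨x, h hx⟩ :=
  colimit.ι_desc _ _

/-- The functor sending a subset `S` satisfying `P` to the colimit of the restriction
of `D` to `S`. -/
noncomputable def colimitOverSubsets : Subtype P ⥤ C where
  obj S := colimit (restrictToSet D S.1)
  map h := colimitOverSubsetsMap D (leOfHom h)
  map_id S := colimit.hom_ext fun x =>
    (ι_colimitOverSubsetsMap D _ x.1 x.2).trans (Category.comp_id _).symm
  map_comp f g := colimit.hom_ext fun x => by
    rw [ι_colimitOverSubsetsMap, ← Category.assoc, ι_colimitOverSubsetsMap]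
    exact (ι_colimitOverSubsetsMap D (leOfHom g) x.1 (leOfHom f x.2)).symm

/-- The inclusion of the value of `D` at an element of `S` in the colimit over `S`. -/
noncomputable def ιColimitOverSubsets (S : Subtype P) (x : α) (hx : x ∈ S.1) :
    D.obj x ⟶ (colimitOverSubsets D P).obj S :=
  colimit.ι (restrictToSet D S.1) ⟨x, hx⟩

variable {P}

lemma colimitOverSubsets_hom_ext {S : Subtype P} {Y : C}
    {f g : (colimitOverSubsets D P).obj S ⟶ Y}
    (h : ∀ (x : α) (hx : x ∈ S.1),
      ιColimitOverSubsets D P S x hx ≫ f = ιColimitOverSubsets D P S x hx ≫ g) : f = g :=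
  colimit.hom_ext fun x => h x.1 x.2

lemma ιColimitOverSubsets_map {S T : Subtype P} (h : S ⟶ T) (x : α) (hx : x ∈ S.1) :
    ιColimitOverSubsets D P S x hx ≫ (colimitOverSubsets D P).map h =
      ιColimitOverSubsets D P T x (leOfHom h hx) :=
  colimit.ι_desc _ _

lemma map_ιColimitOverSubsets (S : Subtype P) {x y : α} (f : x ⟶ y) (hx : x ∈ S.1)
    (hy : y ∈ S.1) :
    D.map f ≫ ιColimitOverSubsets D P S y hy = ιColimitOverSubsets D P S x hx :=
  colimit.w (restrictToSet D S.1) (homOfLE (leOfHom f) : (⟨x, hx⟩ : S.1) ⟶ ⟨y, hy⟩)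

variable {D} (c : Cocone D)

/-- The morphism from the colimit over a subset to the point of a cocone over `D`. -/
noncomputable def descOverSubset (S : Subtype P) : (colimitOverSubsets D P).obj S ⟶ c.pt :=
  colimit.desc (restrictToSet D S.1) (c.whisker _)

lemma ιColimitOverSubsets_descOverSubset (S : Subtype P) (x : α) (hx : x ∈ S.1) :
    ιColimitOverSubsets D P S x hx ≫ descOverSubset c S = c.ι.app x :=
  colimit.ι_desc _ _

lemma map_descOverSubset {S T : Subtype P} (h : S ⟶ T) :
    (colimitOverSubsets D P).map h ≫ descOverSubset c T = descOverSubset c S :=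
  colimitOverSubsets_hom_ext D fun x hx => by
    rw [← Category.assoc, ιColimitOverSubsets_map, ιColimitOverSubsets_descOverSubset,
      ιColimitOverSubsets_descOverSubset]

variable (P) in
/-- The cocone over `colimitOverSubsets D P` induced by a cocone over `D`. -/
noncomputable def coconeOverSubsets : Cocone (colimitOverSubsets D P) where
  pt := c.pt
  ι :=
    { app := descOverSubset c
      naturality := fun _ _ h => (map_descOverSubset c h).trans (Category.comp_id _).symm }

lemma ιColimitOverSubsets_coconeOverSubsets (S : Subtype P) (x : α) (hx : x ∈ S.1) :
    ιColimitOverSubsets D P S x hx ≫ (coconeOverSubsets P c).ι.app S = c.ι.app x :=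
  ιColimitOverSubsets_descOverSubset c S x hx

/-- Compare both sides in a common upper bound of `S` and `T`. This makes the choices in
`coconeOfOverSubsets` harmless. -/
lemma ιColimitOverSubsets_comp_eq [IsDirectedOrder (Subtype P)]
    (s : Cocone (colimitOverSubsets D P)) (S T : Subtype P) {x : α} (hS : x ∈ S.1)
    (hT : x ∈ T.1) :
    ιColimitOverSubsets D P S x hS ≫ s.ι.app S = ιColimitOverSubsets D P T x hT ≫ s.ι.app T := by
  obtain ⟨U, hSU, hTU⟩ := exists_ge_ge S T
  rw [← s.w (homOfLE hSU), ← s.w (homOfLE hTU), ← Category.assoc, ← Category.assoc,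
    ιColimitOverSubsets_map, ιColimitOverSubsets_map]

/-- The cocone over `D` induced by a cocone over `colimitOverSubsets D P`, when `P` is
a directed family of subsets covering `α`. -/
noncomputable def coconeOfOverSubsets [IsDirectedOrder (Subtype P)]
    (s : Cocone (colimitOverSubsets D P)) (hP : ∀ x : α, ∃ S : Subtype P, x ∈ S.1) :
    Cocone D where
  pt := s.pt
  ι :=
    { app := fun x => ιColimitOverSubsets D P (hP x).choose x (hP x).choose_spec ≫
        s.ι.app (hP x).choose
      naturality := fun x y f => by
        obtain ⟨U, hxU, hyU⟩ := exists_ge_ge (hP x).choose (hP y).choose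
        have hx : x ∈ U.1 := hxU (hP x).choose_spec
        have hy : y ∈ U.1 := hyU (hP y).choose_spec
        rw [ιColimitOverSubsets_comp_eq s _ U _ hx, ιColimitOverSubsets_comp_eq s _ U _ hy,
          ← Category.assoc, map_ιColimitOverSubsets D U f hx hy]
        exact (Category.comp_id _).symm }

lemma coconeOfOverSubsets_ι_app [IsDirectedOrder (Subtype P)]
    (s : Cocone (colimitOverSubsets D P)) (hP : ∀ x : α, ∃ S : Subtype P, x ∈ S.1)
    (S : Subtype P) (x : α) (hx : x ∈ S.1) :
    (coconeOfOverSubsets s hP).ι.app x = ιColimitOverSubsets D P S x hx ≫ s.ι.app S :=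
  ιColimitOverSubsets_comp_eq s _ S _ hx

variable {c} in
/-- If `P` is a directed family of subsets covering `α`, then the colimit of `D` is the colimit
of the colimits of its restrictions to the subsets satisfying `P`. -/
noncomputable def isColimitCoconeOverSubsets [IsDirectedOrder (Subtype P)] (hc : IsColimit c)
    (hP : ∀ x : α, ∃ S : Subtype P, x ∈ S.1) :
    IsColimit (coconeOverSubsets P c) where
  desc s := hc.desc (coconeOfOverSubsets s hP)
  fac s S := colimitOverSubsets_hom_ext D fun x hx =>
    (Category.assoc _ _ _).symm.trans <|
      (congrArg (· ≫ hc.desc (coconeOfOverSubsets s hP))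
        (ιColimitOverSubsets_coconeOverSubsets c S x hx)).trans <|
      (hc.fac _ x).trans (coconeOfOverSubsets_ι_app s hP S x hx)
  uniq s m hm := hc.hom_ext fun x => by
    obtain ⟨S, hx⟩ := hP x
    refine Eq.trans ?_ (hc.fac (coconeOfOverSubsets s hP) x).symm
    rw [coconeOfOverSubsets_ι_app s hP S x hx, ← hm S, ← Category.assoc,
      ιColimitOverSubsets_coconeOverSubsets]
    rfl

end SubsetDecomposition

/-- The reason for the form `(2 ^ ν)⁺`: a set of size at most `2 ^ ν` has at most `(2 ^ ν) ^ ν = 2 ^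
ν` subsets of size at most `ν`. -/
lemma hasCardinalLT_setCardinalLT {κ ν : Cardinal.{w}} (hν : Cardinal.aleph0 ≤ ν) (h : κ ≤ ν)
    {X : Type w} (hX : HasCardinalLT X (Order.succ (2 ^ ν))) :
    HasCardinalLT (CardinalDirectedPoset.SetCardinalLT κ X) (Order.succ (2 ^ ν)) := by
  rw [hasCardinalLT_iff_cardinal_mk_lt, Order.lt_succ_iff] at hX ⊢
  have h₁ : Cardinal.mk (CardinalDirectedPoset.SetCardinalLT κ X) ≤
      Cardinal.mk { t : Set X // Cardinal.mk t ≤ ν } :=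
    Cardinal.mk_subtype_mono fun t ht =>
      ((hasCardinalLT_iff_cardinal_mk_lt _ _).1 ht).le.trans h
  refine h₁.trans ((Cardinal.mk_bounded_set_le X ν).trans ?_)
  calc
    max (Cardinal.mk X) Cardinal.aleph0 ^ ν ≤ (2 ^ ν) ^ ν :=
      Cardinal.power_le_power_right (max_le hX (hν.trans (Cardinal.cantor ν).le))
    _ = 2 ^ ν := by rw [← Cardinal.power_mul, Cardinal.mul_eq_self hν]

/-- Any `κ`-directed partially ordered type is covered by its `κ`-directed subsets of cardinality
`≤ 2 ^ ν` as soon as `κ ≤ ν`. -/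
lemma exists_isCardinalFiltered_superset {κ ν : Cardinal.{w}} [Fact κ.IsRegular]
    (h : κ ≤ ν) [Fact (Cardinal.IsRegular (Order.succ (2 ^ ν)))]
    {α : Type w} [PartialOrder α] [IsCardinalFiltered α κ] (A : Set α)
    (hA : HasCardinalLT A (Order.succ (2 ^ ν))) :
    ∃ B : Set α, A ⊆ B ∧ IsCardinalFiltered B κ ∧ HasCardinalLT B (Order.succ (2 ^ ν)) := by
  have hκ : κ.IsRegular := Fact.out
  refine Cardinal.SharplyLT.exists_isCardinalFiltered_set_of_exists_cofinal
    ((h.trans (Cardinal.cantor ν).le).trans_lt (Order.lt_succ _)) (fun X hX => ?_) A hA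
  -- There are so few small subsets that all of them together serve as the cofinal family.
  exact ⟨Set.univ, (hasCardinalLT_setCardinalLT (hκ.aleph0_le.trans h) h hX).of_injective _
    Subtype.val_injective, fun x => ⟨x, Set.mem_univ x, le_rfl⟩⟩

lemma hasCardinalLT_arrow_of_preorder {κ : Cardinal.{w}} (hκ : Cardinal.aleph0 ≤ κ)
    {α : Type w} [Preorder α] (hα : HasCardinalLT α κ) : HasCardinalLT (Arrow α) κ := by
  refine (hasCardinalLT_prod hκ hα hα).of_injective (fun f : Arrow α => (f.left, f.right)) ?_
  rintro ⟨a, b, f⟩ ⟨a', b', f'⟩ h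
  obtain ⟨rfl, rfl⟩ := Prod.mk.inj h
  obtain rfl : f = f' := Subsingleton.elim _ _
  rfl

/-- The subsets relevant in the decomposition of `κ`-filtered colimits as
`κ'`-filtered colimits of `κ`-filtered colimits of size `< κ'`. -/
def IsSmallCardinalDirected {α : Type w} [PartialOrder α] (κ κ' : Cardinal.{w})
    [Fact κ.IsRegular] (S : Set α) : Prop :=
  IsCardinalFiltered S κ ∧ HasCardinalLT S κ'

lemma isCardinalFiltered_isSmallCardinalDirected {α : Type w} [PartialOrder α]
    {κ κ' : Cardinal.{w}} [Fact κ.IsRegular] [Fact κ'.IsRegular]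
    (H : ∀ A : Set α, HasCardinalLT A κ' →
      ∃ B : Set α, A ⊆ B ∧ IsCardinalFiltered B κ ∧ HasCardinalLT B κ') :
    IsCardinalFiltered (Subtype (IsSmallCardinalDirected (α := α) κ κ')) κ' :=
  isCardinalFiltered_preorder _ _ fun K s hK => by
    obtain ⟨B, hAB, hB⟩ := H (⋃ k, (s k).1)
      (hasCardinalLT_iUnion _ (by rwa [hasCardinalLT_iff_cardinal_mk_lt]) fun k => (s k).2.2)
    exact ⟨⟨B, hB⟩, fun k => (Set.subset_iUnion (fun k => (s k).1) k).trans hAB⟩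

/-- If `F` is an accessible functor from a `κ`-accessible category, then for `κ'` large enough,
every morphism `X ⟶ F.obj Y` from a `κ'`-presentable object `X` factors through the image of
a `κ'`-small colimit of objects of a given generator. -/
lemma exists_factorization_colimitsCardinalClosure
    {L : Type u₁} [Category.{v₁} L] {K : Type u} [Category.{v} K] (F : L ⥤ K)
    {κ ν : Cardinal.{w}} [Fact κ.IsRegular] [Fact (Cardinal.IsRegular (Order.succ (2 ^ ν)))] (hκ : κ ≤ ν)
    [HasCardinalFilteredColimits L κ] [F.IsCardinalAccessible (Order.succ (2 ^ ν))]
    {P : ObjectProperty L} (hP : P.IsCardinalFilteredGenerator κ)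
    (X : K) [IsCardinalPresentable X (Order.succ (2 ^ ν))] {Y : L} (f : X ⟶ F.obj Y) :
    ∃ (Z : L) (_ : P.colimitsCardinalClosure (Order.succ (2 ^ ν)) Z) (g : X ⟶ F.obj Z)
      (l : Z ⟶ Y), f = g ≫ F.map l := by
  obtain ⟨J, _, _, ⟨p₀⟩⟩ := hP.exists_colimitsOfShape Y
  -- Pass to a directed poset, so that subdiagrams are just subsets.
  obtain ⟨α, _, _, G, _⟩ := IsCardinalFiltered.exists_cardinal_directed J κ
  let p := p₀.reindex G
  have hreg : Cardinal.IsRegular (Order.succ (2 ^ ν)) := Fact.out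
  let Q : Set α → Prop := IsSmallCardinalDirected κ (Order.succ (2 ^ ν))
  have (S : Subtype Q) : IsCardinalFiltered S.1 κ := S.2.1
  have (S : Subtype Q) : HasColimit (restrictToSet p.diag S.1) :=
    have := HasCardinalFilteredColimits.hasColimitsOfShape (κ := κ) L S.1
    inferInstance
  have hQ : IsCardinalFiltered (Subtype Q) (Order.succ (2 ^ ν)) :=
    isCardinalFiltered_isSmallCardinalDirected (exists_isCardinalFiltered_superset hκ)
  have : IsFiltered (Subtype Q) := isFiltered_of_isCardinalFiltered _ (Order.succ (2 ^ ν))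
  have : IsDirectedOrder (Subtype Q) := IsFiltered.isDirectedOrder _
  have hc := isColimitCoconeOverSubsets (P := Q) p.isColimit fun x => by
    obtain ⟨B, hB, hB'⟩ := exists_isCardinalFiltered_superset hκ {x}
      (hasCardinalLT_of_finite _ _ hreg.aleph0_le)
    exact ⟨⟨B, hB'⟩, hB rfl⟩
  have := F.preservesColimitsOfShape_of_isCardinalAccessible (Order.succ (2 ^ ν)) (Subtype Q)
  obtain ⟨S, g, hg⟩ := IsCardinalPresentable.exists_hom_of_isColimit (Order.succ (2 ^ ν))
    (isColimitOfPreserves F hc) f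
  have := P.isClosedUnderColimitsOfShape_colimitsCardinalClosure (Order.succ (2 ^ ν)) S.1
    (hasCardinalLT_arrow_of_preorder hreg.aleph0_le S.2.2)
  exact ⟨colimit (restrictToSet p.diag S.1),
    ObjectProperty.prop_colimit _ _ fun x =>
      P.le_colimitsCardinalClosure _ _ (p.prop_diag_obj x.1),
    g, (coconeOverSubsets Q p.cocone).ι.app S, hg.symm⟩

/-- The full image of `F` satisfies the solution-set condition at `X` if all morphisms
`X ⟶ F.obj Y` factor through the images of objects of an essentially small property. -/
lemma solutionSetConditionAt_fullImage_of_essentiallySmall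
    {L : Type u₁} [Category.{v₁} L] {K : Type u} [Category.{v} K] [LocallySmall.{w} K]
    (F : L ⥤ K) (X : K) (P : ObjectProperty L) [ObjectProperty.EssentiallySmall.{w} P]
    (h : ∀ (Y : L) (f : X ⟶ F.obj Y), ∃ (Z : L) (_ : P Z) (g : X ⟶ F.obj Z) (l : Z ⟶ Y),
      f = g ≫ F.map l) :
    ObjectProperty.SolutionSetConditionAt.{w} F.fullImage X := by
  obtain ⟨Q, _, _, hPQ⟩ := ObjectProperty.EssentiallySmall.exists_small_le.{w} P
  -- `T` is `w`-small because `Q` is small and `K` is locally small.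
  let T := Σ Z : Subtype Q, (X ⟶ F.obj Z.1)
  let e := equivShrink.{w} T
  refine ⟨Shrink.{w} T, fun i => F.obj (e.symm i).1.1, fun i => (e.symm i).2,
    fun i => ⟨_, rfl⟩, ?_⟩
  rintro _ ⟨Y, rfl⟩ f
  obtain ⟨Z, hZ, g, l, rfl⟩ := h Y f
  obtain ⟨Z', hZ', ⟨a⟩⟩ := hPQ Z hZ
  obtain ⟨i, hi⟩ := e.symm.surjective ⟨⟨Z', hZ'⟩, g ≫ F.map a.hom⟩
  refine ⟨i, ?_⟩
  dsimp only
  rw [hi]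
  exact ⟨F.map (a.inv ≫ l), by simp [← Functor.map_comp]⟩

end CategoryTheory

theorem proposition2p4 {L : Type u₁} [Category.{v₁} L] {K : Type u} [Category.{v} K]
    [IsAccessibleCategory.{w} L] [IsAccessibleCategory.{w} K]
    (F : L ⥤ K) [Functor.IsAccessible.{w} F] :
    ObjectProperty.IsConeReflective.{w} F.fullImage := by
  intro X
  obtain ⟨κ, _, _⟩ := IsAccessibleCategory.exists_cardinal.{w} L
  obtain ⟨κK, _, _⟩ := IsAccessibleCategory.exists_cardinal.{w} K
  obtain ⟨κF, _, _⟩ := Functor.IsAccessible.exists_cardinal (F := F)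
  obtain ⟨κX, _, _⟩ := (inferInstance : IsPresentable.{w} X).exists_cardinal
  obtain ⟨P, _, hP⟩ := HasCardinalFilteredGenerator.exists_generator L κ
  -- Ranks of presentability and accessibility may be raised freely; only `κ` needs the sharp
  -- inequality.
  let ν := max κ (max κF κX)
  have hκ : κ.IsRegular := Fact.out
  have hν : ν ≤ Order.succ (2 ^ ν) := (Cardinal.cantor ν).le.trans (Order.le_succ _)
  have : Fact (Cardinal.IsRegular (Order.succ (2 ^ ν))) :=
    ⟨Cardinal.isRegular_succ
      ((hκ.aleph0_le.trans (le_max_left _ _)).trans (Cardinal.cantor ν).le)⟩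
  have := F.isCardinalAccessible_of_le
    (((le_max_left κF κX).trans (le_max_right κ _)).trans hν)
  have : IsCardinalPresentable X κX := ‹_›
  have := isCardinalPresentable_of_le X
    (((le_max_right κF κX).trans (le_max_right κ _)).trans hν)
  exact solutionSetConditionAt_fullImage_of_essentiallySmall F X
    (P.colimitsCardinalClosure (Order.succ (2 ^ ν)))
    fun _ => exists_factorization_colimitsCardinalClosure F (le_max_left _ _) hP X
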